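/- For a finite simple graph $G$ let $\rho(G)$ denote its spectral radius, i.e. the largest eigenvalue of its adjacency matrix. For $2\le s\le t$ let $K^-_{s,t}$ be the graph obtained from the complete bipartite graph $K_{s,t}$ (with parts of orders $s$ and $t$) by deleting one edge, and let $K^+_{s,t}$ be the graph obtained from $K_{s,t}$ by adding a new vertex $x$ and a new edge $xy$, where $y$ is a vertex in the part of order $s$. For $e\ge 2$ let $\rho(e)$ be the maximum of $\rho(H)$ over all finite bipartite graphs $H$ with $e$ edges that are not the union of a complete bipartite graph and some (possibly no) isolated vertices. Theorem 5.1. Let $e\ge 4$ and let $G$ be a bipartite graph with $e$ edges and without isolated vertices such that $\rho(G)=\rho(e)$. Then, up to isomorphism, the following hold. (i) If $e$ is odd, then $G=K^-_{2,q}$, where $q=(e+1)/2$. (ii) If $e$ is even, $e-1$ is prime and $e+1$ is not prime, then $G=K^-_{p',q'}$, where $p'\ge 3$ is the least integer $\ge 3$ that divides $e+1$ and $q'=(e+1)/p'$. (iii) If $e$ is even, $e-1$ is not prime and $e+1$ is prime, then $G=K^+_{p'',q''}$, where $p''\ge 3$ is the least integer $\ge 3$ that divides $e-1$ and $q''=(e-1)/p''$.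 (iv) If $e$ is even and neither $e-1$ nor $e+1$ is prime, then $G$ is $K^-_{p',q'}$ or $K^+_{p'',q''}$, where $p',q'$ are as in (ii) and $p'',q''$ are as in (iii). -/

import Mathlib

/-- The largest eigenvalue of the adjacency matrix of a finite graph. -/
noncomputable def SimpleGraph.largestEigenvalue {V : Type*} [Fintype V] (G : SimpleGraph V) : ℝ :=
  open Classical in
  sSup {μ : ℝ | Module.End.HasEigenvalue (Matrix.toLin' (G.adjMatrix ℝ)) μ}

/-- `G` is the union of a complete bipartite graph, with parts `X` and `Y`, and some (possibly no)
isolated vertices, namely those outside `X ∪ Y`. -/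
def SimpleGraph.IsCompleteBipartiteWithIsolated {V : Type*} (G : SimpleGraph V) : Prop :=
  ∃ X Y : Set V, Disjoint X Y ∧
    ∀ u v : V, G.Adj u v ↔ (u ∈ X ∧ v ∈ Y) ∨ (u ∈ Y ∧ v ∈ X)

/-- The values `ρ(H)`, where `H` runs over all finite bipartite graphs with `e` edges that are not
the union of a complete bipartite graph and some isolated vertices. Every finite graph is
isomorphic to one on some `Fin n`. -/
def nonCompleteBipartiteRadii (e : ℕ) : Set ℝ :=
  {r : ℝ | ∃ (n : ℕ) (H : SimpleGraph (Fin n)), H.IsBipartite ∧ H.edgeSet.ncard = e ∧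
    ¬ H.IsCompleteBipartiteWithIsolated ∧ r = H.largestEigenvalue}

/-- `ρ(e)`, the largest value in `nonCompleteBipartiteRadii e`. For `e ≥ 2` that set is finite and
nonempty, so the supremum is a maximum. -/
noncomputable def maxNonCompleteBipartiteRadius (e : ℕ) : ℝ :=
  sSup (nonCompleteBipartiteRadii e)

/-- `G` is (isomorphic to) `K⁻_{s,t}`: the complete bipartite graph with parts of orders `s` and
`t`, with one edge deleted. All choices of the edge give isomorphic graphs. -/
def SimpleGraph.IsKMinus {V : Type*} (G : SimpleGraph V) (s t : ℕ) : Prop :=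
  ∃ (i : Fin s) (j : Fin t),
    Nonempty (G ≃g (completeBipartiteGraph (Fin s) (Fin t)).deleteEdges {s(Sum.inl i, Sum.inr j)})

/-- `G` is (isomorphic to) `K⁺_{s,t}`: the complete bipartite graph with parts of orders `s` and
`t`, with a new vertex `none` and one new edge, which joins `none` to a vertex of the part of
order `s`. All choices of that vertex give isomorphic graphs. -/
def SimpleGraph.IsKPlus {V : Type*} (G : SimpleGraph V) (s t : ℕ) : Prop :=
  ∃ i : Fin s,
    Nonempty (G ≃g ((completeBipartiteGraph (Fin s) (Fin t)).map Function.Embedding.some ⊔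
      SimpleGraph.edge none (some (Sum.inl i))))

/-! Encode a bipartite graph by a biadjacency relation `R` with 0/1 matrix `M`. Call an ordered pair
of edges bad if their ends do not span a complete bipartite graph, and let `N` be the number of bad
pairs. The spectrum is symmetric. Half the sum of its squares is `tr(M Mᵀ) = e`, and half the sum of
its fourth powers is `tr((M Mᵀ)²) = e² - N`. Hence few bad pairs force `ρ²` close to `e`, and
conversely (`bipGraph_spectral`).

The estimates are sharp enough to compare graphs. If some competitor has `N = 2D > 0` with `D + 3 ≤
e`, then a graph attaining `ρ(e)` has `0 < N ≤ 2D + 1` (`card_badPairs_le_of_max`). Suitable graphs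
`K⁻` and `K⁺` are such competitors, so the extremal graph satisfies `N + 4 < 2e`.

The remainder is combinatorial. A graph without isolated vertices and with `N + 4 < 2e` is complete
bipartite, a `K⁻` or a `K⁺` (`few_badPairs_classification`): without a dominating edge `N ≥ 2e - 2`,
and with one, `N` is bounded below through the numbers of dominating vertices. Finally `N =
2(s-1)(t-1)` for `K⁻_{s,t}` and `N = 2(s-1)t` for `K⁺_{s,t}`. For a fixed product `st`, both favour
the most unbalanced factorisation, hence the least admissible divisor; as `N` is even here, the
slack of 1 is harmless. -/

/-! ### Eigenvalues, traces and power sums. -/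

open Matrix in
theorem Matrix.IsHermitian.trace_mul_self_eq_sum {n : Type*} [Fintype n] [DecidableEq n]
    {A : Matrix n n ℝ} (hA : A.IsHermitian) :
    (A * A).trace = ∑ i, hA.eigenvalues i ^ 2 ∧
      ((A * A) * (A * A)).trace = ∑ i, hA.eigenvalues i ^ 4 := by
  have tr : ∀ D : Matrix n n ℝ,
      (Unitary.conjStarAlgAut ℝ _ hA.eigenvectorUnitary D).trace = D.trace := by
    intro D
    rw [Unitary.conjStarAlgAut_apply, Matrix.trace_mul_comm, ← mul_assoc]
    simp
  have h := hA.spectral_theorem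
  set φ := Unitary.conjStarAlgAut ℝ (Matrix n n ℝ) hA.eigenvectorUnitary with hφ
  set D : Matrix n n ℝ := diagonal (RCLike.ofReal ∘ hA.eigenvalues) with hD
  have h2 : A * A = φ (D * D) := by rw [map_mul, ← h]
  have h4 : (A * A) * (A * A) = φ ((D * D) * (D * D)) := by rw [map_mul, ← h2]
  rw [h4, h2, tr, tr, hD]
  constructor
  · simp [Matrix.trace, diagonal_mul_diagonal, sq]
  · simp only [diagonal_mul_diagonal, Matrix.trace_diagonal]
    refine Finset.sum_congr rfl fun i _ => ?_
    simp; ring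

/-- Power-sum estimates for a finite family of reals whose extreme values are `ρ` and `-ρ`. -/
theorem power_sum_bounds {ι : Type*} [Fintype ι] [DecidableEq ι] (μ : ι → ℝ) (ρ e H : ℝ)
    {i j : ι} (hij : i ≠ j) (hi : μ i = ρ) (hj : μ j = -ρ) (hle : ∀ k, |μ k| ≤ ρ)
    (h2 : ∑ k, μ k ^ 2 = 2 * e) (h4 : ∑ k, μ k ^ 4 = 2 * H) :
    ρ ^ 2 ≤ e ∧ ρ ^ 4 ≤ H ∧ H ≤ e * ρ ^ 2 ∧ H ≤ ρ ^ 4 + 2 * (e - ρ ^ 2) ^ 2 := by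
  have hj' : j ∈ Finset.univ.erase i := by simp [hij.symm]
  have split : ∀ f : ι → ℝ, ∑ k, f k = f i + f j + ∑ k ∈ (Finset.univ.erase i).erase j, f k := by
    intro f
    rw [← Finset.add_sum_erase _ _ (Finset.mem_univ i), ← Finset.add_sum_erase _ _ hj', add_assoc]
  set T := (Finset.univ.erase i).erase j
  have s2 := split fun k => μ k ^ 2
  have s4 := split fun k => μ k ^ 4
  simp only [hi, hj, h2, h4] at s2 s4
  have p2 : 0 ≤ ∑ k ∈ T, μ k ^ 2 := Finset.sum_nonneg fun _ _ => by positivity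
  have p4 : 0 ≤ ∑ k ∈ T, μ k ^ 4 := Finset.sum_nonneg fun _ _ => by positivity
  -- Apart from `±ρ` the squares sum to `2(e - ρ²)`, so the fourth powers contribute at most the
  -- square of that; this gives the last bound.
  have q4 : ∑ k ∈ T, μ k ^ 4 ≤ (∑ k ∈ T, μ k ^ 2) ^ 2 := by
    have := Finset.sum_sq_le_sq_sum_of_nonneg (s := T) (f := fun k => μ k ^ 2)
      (fun _ _ => by positivity)
    refine le_trans (le_of_eq (Finset.sum_congr rfl fun k _ => ?_)) this
    ring
  have m4 : ∑ k, μ k ^ 4 ≤ ∑ k, ρ ^ 2 * μ k ^ 2 := by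
    refine Finset.sum_le_sum fun k _ => ?_
    have : μ k ^ 2 ≤ ρ ^ 2 := sq_le_sq' (abs_le.1 (hle k)).1 (abs_le.1 (hle k)).2
    nlinarith [sq_nonneg (μ k)]
  rw [← Finset.mul_sum, h2, h4] at m4
  have n2 : (-ρ) ^ 2 = ρ ^ 2 := by ring
  have n4 : (-ρ) ^ 4 = ρ ^ 4 := by ring
  rw [n2] at s2
  rw [n4] at s4
  refine ⟨by linarith, by linarith, by linarith, ?_⟩
  have : ∑ k ∈ T, μ k ^ 2 = 2 * (e - ρ ^ 2) := by linarith
  rw [this] at q4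
  nlinarith

open Classical in
theorem SimpleGraph.hasEigenvalue_adjMatrix_iff {V : Type*} [Fintype V] (G : SimpleGraph V)
    (μ : ℝ) : Module.End.HasEigenvalue (Matrix.toLin' (G.adjMatrix ℝ)) μ ↔
      ∃ w : V → ℝ, w ≠ 0 ∧ ∀ v, ∑ u, (if G.Adj v u then w u else 0) = μ * w v := by
  constructor
  · intro h
    obtain ⟨w, hw⟩ := h.exists_hasEigenvector
    refine ⟨w, hw.2, fun v => ?_⟩
    have := congrFun hw.apply_eq_smul v
    simpa [Matrix.mulVec, dotProduct, SimpleGraph.adjMatrix_apply] using this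
  · rintro ⟨w, hw, h⟩
    refine Module.End.hasEigenvalue_of_hasEigenvector (x := w)
      (Module.End.hasEigenvector_iff.2 ⟨Module.End.mem_eigenspace_iff.2 ?_, hw⟩)
    funext v
    simpa [Matrix.mulVec, dotProduct, SimpleGraph.adjMatrix_apply] using h v

open Classical in
theorem SimpleGraph.largestEigenvalue_eq {V : Type*} [Fintype V] (G : SimpleGraph V) :
    G.largestEigenvalue = sSup {μ : ℝ | ∃ w : V → ℝ, w ≠ 0 ∧
      ∀ v, ∑ u, (if G.Adj v u then w u else 0) = μ * w v} := by
  unfold SimpleGraph.largestEigenvalue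
  congr 1
  ext μ
  exact G.hasEigenvalue_adjMatrix_iff μ

theorem SimpleGraph.Iso.largestEigenvalue_eq {V W : Type*} [Fintype V] [Fintype W]
    {G : SimpleGraph V} {H : SimpleGraph W} (f : G ≃g H) :
    G.largestEigenvalue = H.largestEigenvalue := by
  classical
  rw [G.largestEigenvalue_eq, H.largestEigenvalue_eq]
  congr 1
  ext μ
  constructor
  · rintro ⟨w, hw, h⟩
    refine ⟨fun x => w (f.symm x), fun h0 => hw (funext fun v => ?_), fun v => ?_⟩
    · simpa using congrFun h0 (f v)
    · rw [← h, ← f.toEquiv.sum_comp]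
      refine Finset.sum_congr rfl fun u _ => ?_
      have : H.Adj v (f u) ↔ G.Adj (f.symm v) u := by
        rw [← f.map_adj_iff]; simp
      simp [this]
  · rintro ⟨w, hw, h⟩
    refine ⟨fun x => w (f x), fun h0 => hw (funext fun v => ?_), fun v => ?_⟩
    · simpa using congrFun h0 (f.symm v)
    · rw [← h, ← f.toEquiv.sum_comp]
      refine Finset.sum_congr rfl fun u _ => ?_
      have : H.Adj (f v) (f u) ↔ G.Adj v u := f.map_adj_iff
      simp [this]

/-! ### Biadjacency relations, their edges and bad pairs. -/

/-- The bipartite graph with biadjacency relation `R`. -/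
def bipGraph {X Y : Type*} (R : X → Y → Prop) : SimpleGraph (X ⊕ Y) where
  Adj u v := match u, v with
    | .inl x, .inr y => R x y
    | .inr y, .inl x => R x y
    | _, _ => False
  symm := ⟨by rintro (u | u) (v | v) h <;> exact h⟩
  loopless := ⟨by rintro (u | u) h <;> exact h⟩

section
variable {X Y : Type*} (R : X → Y → Prop)

@[simp] theorem bipGraph_adj_inl_inr (x : X) (y : Y) :
    (bipGraph R).Adj (.inl x) (.inr y) ↔ R x y := Iff.rfl
@[simp] theorem bipGraph_adj_inr_inl (x : X) (y : Y) :
    (bipGraph R).Adj (.inr y) (.inl x) ↔ R x y := Iff.rfl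
@[simp] theorem bipGraph_adj_inl_inl (x x' : X) :
    ¬ (bipGraph R).Adj (.inl x) (.inl x') := id
@[simp] theorem bipGraph_adj_inr_inr (y y' : Y) :
    ¬ (bipGraph R).Adj (.inr y) (.inr y') := id

open Classical in
/-- The set of edges of the bipartite graph with biadjacency relation `R`. -/
noncomputable def biEdges [Fintype X] [Fintype Y] : Finset (X × Y) :=
  Finset.univ.filter fun p => R p.1 p.2

open Classical in
/-- The ordered pairs of edges whose ends do not span a complete bipartite graph. -/
noncomputable def badPairs [Fintype X] [Fintype Y] : Finset ((X × Y) × (X × Y)) :=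
  Finset.univ.filter fun p => R p.1.1 p.1.2 ∧ R p.2.1 p.2.2 ∧ ¬ (R p.1.1 p.2.2 ∧ R p.2.1 p.1.2)

variable {R}

@[simp] theorem mem_biEdges [Fintype X] [Fintype Y] {p : X × Y} : p ∈ biEdges R ↔ R p.1 p.2 := by
  simp [biEdges]

@[simp] theorem mem_badPairs [Fintype X] [Fintype Y] {p : (X × Y) × (X × Y)} :
    p ∈ badPairs R ↔ R p.1.1 p.1.2 ∧ R p.2.1 p.2.2 ∧ ¬ (R p.1.1 p.2.2 ∧ R p.2.1 p.1.2) := by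
  simp [badPairs]

end

theorem Matrix.trace_fromBlocks {m n : Type*} [Fintype m] [Fintype n] (A : Matrix m m ℝ)
    (B : Matrix m n ℝ) (C : Matrix n m ℝ) (D : Matrix n n ℝ) :
    (Matrix.fromBlocks A B C D).trace = A.trace + D.trace := by
  simp [Matrix.trace, Fintype.sum_sum_type]

/-! ### Spectral bounds in terms of the number of bad pairs. -/

section
variable {X Y : Type*} [Fintype X] [Fintype Y] (R : X → Y → Prop)

-- The second trace counts quadruples `(x, y, x', y')` for which all four entries of `M` are 1, that
-- is, the ordered pairs of edges that are not bad.
open Matrix in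
open Classical in
theorem trace_biadjacency :
    let M : Matrix X Y ℝ := Matrix.of fun x y => if R x y then 1 else 0
    (M * Mᵀ).trace = (biEdges R).card ∧
      ((M * Mᵀ) * (M * Mᵀ)).trace = ((biEdges R).card : ℝ) ^ 2 - (badPairs R).card := by
  intro M
  constructor
  · simp only [Matrix.trace, Matrix.diag, Matrix.mul_apply, Matrix.transpose_apply, M,
      Matrix.of_apply, biEdges, Finset.card_filter, Fintype.sum_prod_type]
    push_cast
    refine Finset.sum_congr rfl fun x _ => Finset.sum_congr rfl fun y _ => ?_
    split_ifs <;> simp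
  · have hsplit : ((biEdges R).card : ℝ) ^ 2 - (badPairs R).card = ∑ p : (X × Y) × (X × Y),
        (if R p.1.1 p.1.2 then (1 : ℝ) else 0) * (if R p.2.1 p.2.2 then 1 else 0) *
        ((if R p.1.1 p.2.2 then 1 else 0) * (if R p.2.1 p.1.2 then 1 else 0)) := by
      rw [sq, biEdges, badPairs, Finset.card_filter, Finset.card_filter, sub_eq_iff_eq_add]
      push_cast
      rw [Finset.sum_mul_sum, ← Finset.sum_product', ← Finset.sum_add_distrib]
      refine Finset.sum_congr (by simp) fun p _ => ?_
      by_cases h1 : R p.1.1 p.1.2 <;> by_cases h2 : R p.2.1 p.2.2 <;>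
        by_cases h3 : R p.1.1 p.2.2 <;> by_cases h4 : R p.2.1 p.1.2 <;> simp [h1, h2, h3, h4]
    rw [hsplit]
    simp only [Matrix.trace, Matrix.diag, Matrix.mul_apply, Matrix.transpose_apply, M,
      Matrix.of_apply, Fintype.sum_prod_type, Finset.sum_mul_sum]
    refine Finset.sum_congr rfl fun x _ => ?_
    rw [Finset.sum_comm]
    refine Finset.sum_congr rfl fun y _ => Finset.sum_congr rfl fun x' _ =>
      Finset.sum_congr rfl fun y' _ => ?_
    ring

open Classical in
theorem bipGraph_spectral (he : 0 < (biEdges R).card) :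
    let ρ := (bipGraph R).largestEigenvalue
    let e : ℝ := (biEdges R).card
    let H : ℝ := e ^ 2 - (badPairs R).card
    0 ≤ ρ ∧ ρ ^ 2 ≤ e ∧ ρ ^ 4 ≤ H ∧ H ≤ e * ρ ^ 2 ∧ H ≤ ρ ^ 4 + 2 * (e - ρ ^ 2) ^ 2 := by
  intro ρ e H
  set M : Matrix X Y ℝ := Matrix.of fun x y => if R x y then 1 else 0 with hM
  set A : Matrix (X ⊕ Y) (X ⊕ Y) ℝ := Matrix.fromBlocks 0 M M.transpose 0 with hA
  have hH : A.IsHermitian := by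
    rw [Matrix.IsHermitian, hA, Matrix.fromBlocks_conjTranspose]
    simp
  obtain ⟨t2, t4⟩ := hH.trace_mul_self_eq_sum
  obtain ⟨b2, b4⟩ := trace_biadjacency R
  have hAA : A * A = Matrix.fromBlocks (M * M.transpose) 0 0 (M.transpose * M) := by
    rw [hA, Matrix.fromBlocks_multiply]; simp
  have h2 : ∑ k, hH.eigenvalues k ^ 2 = 2 * e := by
    rw [← t2, hAA, Matrix.trace_fromBlocks, Matrix.trace_mul_comm M.transpose, b2]; ring
  have h4 : ∑ k, hH.eigenvalues k ^ 4 = 2 * H := by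
    rw [← t4, hAA, Matrix.fromBlocks_multiply]
    simp only [Matrix.mul_zero, Matrix.zero_mul, add_zero, zero_add]
    rw [Matrix.trace_fromBlocks, b4]
    have : (M.transpose * M * (M.transpose * M)).trace
        = (M * M.transpose * (M * M.transpose)).trace := by
      rw [Matrix.mul_assoc, Matrix.trace_mul_comm]
      simp only [Matrix.mul_assoc]
    rw [this, b4]; ring
  set S : Set ℝ := {μ : ℝ | ∃ w : X ⊕ Y → ℝ, w ≠ 0 ∧
      ∀ v, ∑ u, (if (bipGraph R).Adj v u then w u else 0) = μ * w v} with hS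
  have hρ : ρ = sSup S := (bipGraph R).largestEigenvalue_eq
  have hentry : ∀ v u, A v u = if (bipGraph R).Adj v u then 1 else 0 := by
    rintro (v | v) (u | u) <;> simp [hA, hM]
  have hmul : ∀ w v, A.mulVec w v = ∑ u, (if (bipGraph R).Adj v u then w u else 0) := by
    intro w v
    simp [Matrix.mulVec, dotProduct, hentry]
  have hrange : S = Set.range hH.eigenvalues := by
    rw [← hH.spectrum_real_eq_range_eigenvalues, ← Matrix.spectrum_toLin' A]
    ext μ
    rw [← Module.End.hasEigenvalue_iff_mem_spectrum]
    constructor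
    · rintro ⟨w, hw, h⟩
      refine Module.End.hasEigenvalue_of_hasEigenvector (x := w)
        (Module.End.hasEigenvector_iff.2 ⟨Module.End.mem_eigenspace_iff.2 ?_, hw⟩)
      funext v
      rw [Matrix.toLin'_apply, hmul, h]; rfl
    · intro h
      obtain ⟨w, hw⟩ := h.exists_hasEigenvector
      refine ⟨w, hw.2, fun v => ?_⟩
      have := congrFun hw.apply_eq_smul v
      rw [Matrix.toLin'_apply, hmul] at this
      exact this
  -- Changing the sign of an eigenvector on one side of the bipartition negates its eigenvalue.
  have hneg : ∀ μ ∈ S, -μ ∈ S := by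
    rintro μ ⟨w, hw, h⟩
    refine ⟨Sum.elim (fun x => w (.inl x)) (fun y => - w (.inr y)), fun h0 => hw ?_, ?_⟩
    · funext v
      rcases v with x | y
      · simpa using congrFun h0 (.inl x)
      · simpa using congrFun h0 (.inr y)
    · rintro (x | y)
      · have := h (.inl x)
        simp only [Fintype.sum_sum_type, bipGraph_adj_inl_inl, bipGraph_adj_inl_inr, if_false,
          Finset.sum_const_zero, zero_add, Sum.elim_inr, Sum.elim_inl] at this ⊢
        rw [neg_mul, ← this, ← Finset.sum_neg_distrib]
        refine Finset.sum_congr rfl fun y _ => ?_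
        split_ifs <;> simp
      · have := h (.inr y)
        simp only [Fintype.sum_sum_type, bipGraph_adj_inr_inr, bipGraph_adj_inr_inl, if_false,
          Finset.sum_const_zero, add_zero, Sum.elim_inr, Sum.elim_inl] at this ⊢
        rw [this]; ring
  have hfin : S.Finite := hrange ▸ Set.finite_range _
  have hne : Nonempty (X ⊕ Y) := by
    obtain ⟨p, _⟩ := Finset.card_pos.1 he
    exact ⟨.inl p.1⟩
  have hSne : S.Nonempty := hrange ▸ Set.range_nonempty _
  have hmem : ρ ∈ S := hρ ▸ hSne.csSup_mem hfin
  have hub : ∀ μ ∈ S, μ ≤ ρ := fun μ hμ => hρ ▸ le_csSup hfin.bddAbove hμ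
  have habs : ∀ k, |hH.eigenvalues k| ≤ ρ := fun k => by
    have hk : hH.eigenvalues k ∈ S := hrange ▸ ⟨k, rfl⟩
    exact abs_le.2 ⟨by linarith [hub _ (hneg _ hk)], hub _ hk⟩
  have h0 : 0 ≤ ρ := (abs_nonneg _).trans (habs hne.some)
  refine ⟨h0, ?_⟩
  -- Needed so that `ρ` and `-ρ` occupy two different indices in the spectrum.
  have hpos : ρ ≠ 0 := by
    intro hz
    have : ∑ k, hH.eigenvalues k ^ 2 = 0 := Finset.sum_eq_zero fun k _ => by
      have := habs k
      rw [hz, abs_nonpos_iff] at this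
      simp [this]
    have hc : (0 : ℝ) < e := by simpa [e] using he
    linarith
  obtain ⟨i, hi⟩ : ρ ∈ Set.range hH.eigenvalues := hrange ▸ hmem
  obtain ⟨j, hj⟩ : -ρ ∈ Set.range hH.eigenvalues := hrange ▸ hneg _ hmem
  refine power_sum_bounds _ ρ e H (i := i) (j := j) ?_ hi hj habs h2 h4
  rintro rfl
  exact hpos (by linarith)

end

/-! ### Lower bounds for the number of bad pairs, and the graphs with few of them. -/

section
variable {X Y : Type*} [Fintype X] [Fintype Y] {R : X → Y → Prop}

theorem swap_mem_badPairs {p : (X × Y) × (X × Y)} (h : p ∈ badPairs R) : p.swap ∈ badPairs R := by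
  simp only [mem_badPairs, Prod.fst_swap, Prod.snd_swap] at h ⊢
  tauto

/-- Badness is symmetric, so a family containing no pair together with its swap may be counted
twice. -/
theorem two_mul_card_le_badPairs {T : Finset ((X × Y) × (X × Y))} (hT : T ⊆ badPairs R)
    (hs : ∀ p ∈ T, p.swap ∉ T) : 2 * T.card ≤ (badPairs R).card := by
  classical
  have hd : Disjoint T (T.image Prod.swap) := by
    rw [Finset.disjoint_left]
    intro p hp hp'
    obtain ⟨q, hq, rfl⟩ := Finset.mem_image.1 hp'
    exact hs q hq hp
  have hc : (T.image Prod.swap).card = T.card :=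
    Finset.card_image_of_injective _ Prod.swap_injective
  have hsub : T ∪ T.image Prod.swap ⊆ badPairs R := by
    refine Finset.union_subset hT fun p hp => ?_
    obtain ⟨q, hq, rfl⟩ := Finset.mem_image.1 hp
    exact swap_mem_badPairs (hT hq)
  have := Finset.card_le_card hsub
  rw [Finset.card_union_of_disjoint hd, hc] at this
  omega

theorem badPairs_card_le_two_mul {T : Finset ((X × Y) × (X × Y))}
    (hs : ∀ p ∈ badPairs R, p ∈ T ∨ p.swap ∈ T) : (badPairs R).card ≤ 2 * T.card := by
  classical
  have hsub : badPairs R ⊆ T ∪ T.image Prod.swap := by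
    intro p hp
    rcases hs p hp with h | h
    · exact Finset.mem_union_left _ h
    · exact Finset.mem_union_right _ (Finset.mem_image.2 ⟨_, h, Prod.swap_swap p⟩)
  have h1 := Finset.card_le_card hsub
  have h2 := Finset.card_union_le T (T.image Prod.swap)
  have h3 : (T.image Prod.swap).card ≤ T.card := Finset.card_image_le
  omega

theorem biEdges_flip_card : (biEdges (flip R)).card = (biEdges R).card := by
  refine Finset.card_bij' (fun p _ => p.swap) (fun p _ => p.swap) ?_ ?_ ?_ ?_ <;> simp [flip]

theorem badPairs_flip_card : (badPairs (flip R)).card = (badPairs R).card := by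
  refine Finset.card_bij' (fun p _ => (p.1.swap, p.2.swap)) (fun p _ => (p.1.swap, p.2.swap))
    ?_ ?_ ?_ ?_
  · rintro ⟨⟨a, b⟩, ⟨c, d⟩⟩
    simp [flip]; tauto
  · rintro ⟨⟨a, b⟩, ⟨c, d⟩⟩
    simp [flip]; tauto
  · simp
  · simp

/-- A vertex of degree one whose neighbour is not dominating forces many bad pairs. -/
theorem card_badPairs_of_leaf (hX : ∀ x, ∃ y, R x y) {v z : X} {b : Y} (hvb : R v b)
    (hv : ∀ c, R v c → c = b) (hz : ¬ R z b) :
    2 * (biEdges R).card ≤ (badPairs R).card + 2 := by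
  classical
  obtain ⟨d, hd⟩ := hX z
  have hdb : d ≠ b := by rintro rfl; exact hz hd
  -- Every edge other than `(v, b)` gets a bad partner: away from `b` the pendant edge works, since
  -- `v` has no other neighbour; at `b` the edge `(z, d)` works, since `z` misses `b`. This gives `e
  -- - 1` unordered bad pairs.
  let anchor : X × Y → X × Y := fun f => if f.2 = b then (z, d) else (v, b)
  let T := ((biEdges R).erase (v, b)).image fun f => (anchor f, f)
  have hcard : T.card = (biEdges R).card - 1 := by
    rw [Finset.card_image_of_injective _ fun f g h => (Prod.ext_iff.1 h).2,
      Finset.card_erase_of_mem (by simpa using hvb)]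
  have hT : T ⊆ badPairs R := by
    intro p hp
    obtain ⟨⟨w, c⟩, hf, rfl⟩ := Finset.mem_image.1 hp
    simp only [Finset.mem_erase, mem_biEdges] at hf
    by_cases hc : c = b
    · subst hc
      simp [anchor, hd, hf.2, hz]
    · have : ¬ R v c := fun h => hc (hv c h)
      simp [anchor, hc, hvb, hf.2, this]
  have hs : ∀ p ∈ T, p.swap ∉ T := by
    intro p hp hp'
    obtain ⟨⟨w, c⟩, hf, rfl⟩ := Finset.mem_image.1 hp
    obtain ⟨⟨w', c'⟩, hf', h⟩ := Finset.mem_image.1 hp'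
    simp only [Finset.mem_erase, mem_biEdges, Prod.swap_prod_mk, Prod.mk.injEq] at hf hf' h
    obtain ⟨h1, h2⟩ := h
    by_cases hc : c = b <;> by_cases hc' : c' = b <;> simp_all [anchor]
  have := two_mul_card_le_badPairs hT hs
  omega

open Classical in
theorem card_badPairs_eq_sum : (badPairs R).card =
    ∑ p ∈ biEdges R, ((biEdges R).filter fun q => ¬ (R p.1 q.2 ∧ R q.1 p.2)).card := by
  rw [← Finset.card_sigma]
  refine Finset.card_bij' (fun p _ => ⟨p.1, p.2⟩) (fun p _ => (p.1, p.2)) ?_ ?_ ?_ ?_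
  · rintro ⟨p, q⟩; simp
  · rintro ⟨p, q⟩; simp
  · simp
  · simp

/-- If every edge has two bad partners, then `N ≥ 2e`. Otherwise some edge `(u, a)` has a unique bad
partner `(v, b)`, and uniqueness makes `v` or `b` a leaf. The neighbour of that leaf cannot be
dominating, for it would then lie on a dominating edge; so the leaf bound applies. -/
theorem card_badPairs_of_no_dominating_edge (hX : ∀ x, ∃ y, R x y) (hY : ∀ y, ∃ x, R x y)
    (h : ∀ x y, R x y → ∃ x' y', R x' y' ∧ ¬ (R x y' ∧ R x' y)) :
    2 * (biEdges R).card ≤ (badPairs R).card + 2 := by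
  classical
  by_cases h2 : ∀ p ∈ biEdges R,
      2 ≤ ((biEdges R).filter fun q => ¬ (R p.1 q.2 ∧ R q.1 p.2)).card
  · have := Finset.sum_le_sum h2
    rw [← card_badPairs_eq_sum, Finset.sum_const, smul_eq_mul] at this
    omega
  push Not at h2
  obtain ⟨⟨u, a⟩, hua, hlt⟩ := h2
  have hua : R u a := by simpa using hua
  obtain ⟨v, b, hvb, hbad⟩ := h u a hua
  have huniq : ∀ w c, R w c → ¬ (R u c ∧ R w a) → w = v ∧ c = b := by
    intro w c hwc hwb
    have := Finset.card_le_one.1 (Nat.lt_succ_iff.1 hlt) (w, c) (by simp [hwc]; tauto) (v, b)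
      (by simp [hvb]; tauto)
    simpa using this
  by_cases hva : R v a
  · have hub : ¬ R u b := fun hub => hbad ⟨hub, hva⟩
    have hleaf : ∀ w, R w b → w = v := fun w hw => (huniq w b hw fun h => hub h.1).1
    have hz : ∃ z, ¬ R v z := by
      by_contra hfull
      push Not at hfull
      have ha : ∀ w, R w a := by
        intro w
        by_contra hwa
        obtain ⟨c, hc⟩ := hX w
        obtain ⟨rfl, -⟩ := huniq w c hc fun h => hwa h.2
        exact hwa hva
      obtain ⟨x', y', hxy, hb⟩ := h v a hva
      exact hb ⟨hfull _, ha _⟩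
    obtain ⟨z, hz⟩ := hz
    have := card_badPairs_of_leaf (R := flip R) hY (v := b) (z := z) (b := v) hvb hleaf hz
    rwa [biEdges_flip_card, badPairs_flip_card] at this
  · have hleaf : ∀ c, R v c → c = b := fun c hc => (huniq v c hc fun h => hva h.2).2
    have hz : ∃ z, ¬ R z b := by
      by_contra hfull
      push Not at hfull
      have ha : ∀ c, R u c := by
        intro c
        by_contra huc
        obtain ⟨w, hw⟩ := hY c
        obtain ⟨-, rfl⟩ := huniq w c hw fun h => huc h.1
        exact huc (hfull _)
      obtain ⟨x', y', hxy, hb⟩ := h u b (hfull u)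
      exact hb ⟨ha _, hfull _⟩
    obtain ⟨z, hz⟩ := hz
    exact card_badPairs_of_leaf hX hvb hleaf hz

open Classical in
/-- Counting bad pairs by means of the sets `X₀`, `Y₀` of dominating vertices. -/
theorem card_badPairs_dominating [Nonempty X] [Nonempty Y] :
    let X₀ : Finset X := Finset.univ.filter fun x => ∀ y, R x y
    let Y₀ : Finset Y := Finset.univ.filter fun y => ∀ x, R x y
    ∃ k r : ℕ, (biEdges R).card + k = Fintype.card X * Fintype.card Y ∧
      r + k = X₀ᶜ.card * Y₀ᶜ.card ∧ X₀ᶜ.card ≤ k ∧ Y₀ᶜ.card ≤ k ∧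
      2 * (X₀.card * Y₀.card * k + (X₀.card + Y₀.card) * r) ≤ (badPairs R).card := by
  intro X₀ Y₀
  have mX : ∀ x, x ∈ X₀ ↔ ∀ y, R x y := by simp [X₀]
  have mY : ∀ y, y ∈ Y₀ ↔ ∀ x, R x y := by simp [Y₀]
  have exβ : ∀ v, v ∉ X₀ → ∃ b, ¬ R v b := fun v hv => by simpa [mX] using hv
  have exα : ∀ b, b ∉ Y₀ → ∃ v, ¬ R v b := fun v hv => by simpa [mY] using hv
  choose! β hβ using exβ
  choose! α hα using exα
  let K : Finset (X × Y) := Finset.univ.filter fun p => ¬ R p.1 p.2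
  let E : Finset (X × Y) := (X₀ᶜ ×ˢ Y₀ᶜ).filter fun p => R p.1 p.2
  have mK : ∀ p, p ∈ K ↔ ¬ R p.1 p.2 := by simp [K]
  have mE : ∀ p, p ∈ E ↔ (p.1 ∉ X₀ ∧ p.2 ∉ Y₀) ∧ R p.1 p.2 := by simp [E]
  have hKE : K = (X₀ᶜ ×ˢ Y₀ᶜ).filter fun p => ¬ R p.1 p.2 := by
    ext ⟨v, b⟩
    simp only [mK, Finset.mem_filter, Finset.mem_product, Finset.mem_compl, mX, mY]
    exact ⟨fun h => ⟨⟨fun hv => h (hv _), fun hb => h (hb _)⟩, h⟩, fun h => h.2⟩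
  refine ⟨K.card, E.card, ?_, ?_, ?_, ?_, ?_⟩
  · have := Finset.card_filter_add_card_filter_not (s := (Finset.univ : Finset (X × Y)))
      (fun p => R p.1 p.2)
    rwa [Finset.card_univ, Fintype.card_prod] at this
  · rw [hKE, Finset.card_filter_add_card_filter_not, Finset.card_product]
  · refine Finset.card_le_card_of_injOn (fun v => (v, β v)) ?_ ?_
    · intro v hv
      simpa [mK] using hβ v (by simpa using hv)
    · intro v _ w _ h
      exact (Prod.ext_iff.1 h).1
  · refine Finset.card_le_card_of_injOn (fun b => (α b, b)) ?_ ?_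
    · intro b hb
      simpa [mK] using hα b (by simpa using hb)
    · intro v _ w _ h
      exact (Prod.ext_iff.1 h).2
  -- Bad pairs with exactly one missing cross edge, oriented by which one is missing; no such pair
  -- has its swap in `T`.
  · let T : Finset ((X × Y) × (X × Y)) := (badPairs R).filter fun p =>
      R p.2.1 p.1.2 ∧ ¬ R p.1.1 p.2.2
    have hT : 2 * T.card ≤ (badPairs R).card := by
      refine two_mul_card_le_badPairs (Finset.filter_subset _ _) fun p hp hp' => ?_
      simp only [T, Finset.mem_filter, Prod.fst_swap, Prod.snd_swap] at hp hp'
      exact hp.2.2 hp'.2.1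
    -- In all three families the missing cross edge is a non-edge at a non-dominating vertex. They
    -- are told apart by whether the `Y`-end of the first edge and the `X`-end of the second are
    -- dominating: both in `T₁`, only the latter in `T₂`, only the former in `T₃`.
    let T₁ := ((X₀ ×ˢ Y₀) ×ˢ K).image fun z : (X × Y) × (X × Y) => ((z.2.1, z.1.2), (z.1.1, z.2.2))
    let T₂ := (X₀ ×ˢ E).image fun z : X × (X × Y) => (z.2, (z.1, β z.2.1))
    let T₃ := (Y₀ ×ˢ E).image fun z : Y × (X × Y) => ((α z.2.2, z.1), z.2)
    have c₁ : T₁.card = X₀.card * Y₀.card * K.card := by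
      rw [Finset.card_image_of_injective, Finset.card_product, Finset.card_product]
      rintro ⟨⟨_, _⟩, ⟨_, _⟩⟩ ⟨⟨_, _⟩, ⟨_, _⟩⟩ h
      simp only [Prod.mk.injEq] at h ⊢
      tauto
    have c₂ : T₂.card = X₀.card * E.card := by
      rw [Finset.card_image_of_injective, Finset.card_product]
      rintro ⟨_, ⟨_, _⟩⟩ ⟨_, ⟨_, _⟩⟩ h
      simp only [Prod.mk.injEq] at h ⊢
      tauto
    have c₃ : T₃.card = Y₀.card * E.card := by
      rw [Finset.card_image_of_injective, Finset.card_product]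
      rintro ⟨_, ⟨_, _⟩⟩ ⟨_, ⟨_, _⟩⟩ h
      simp only [Prod.mk.injEq] at h ⊢
      tauto
    have d₁₂ : Disjoint T₁ T₂ := by
      rw [Finset.disjoint_left]
      intro p h1 h2
      obtain ⟨z, hz, rfl⟩ := Finset.mem_image.1 h1
      obtain ⟨w, hw, h⟩ := Finset.mem_image.1 h2
      simp only [Finset.mem_product, mE, Prod.ext_iff] at hz hw h
      exact hw.2.1.2 (h.1.2 ▸ hz.1.2)
    have d₁₂₃ : Disjoint (T₁ ∪ T₂) T₃ := by
      rw [Finset.disjoint_left]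
      intro p h1 h2
      obtain ⟨w, hw, rfl⟩ := Finset.mem_image.1 h2
      simp only [Finset.mem_product, mE] at hw
      rcases Finset.mem_union.1 h1 with h1 | h1
      · obtain ⟨z, hz, h⟩ := Finset.mem_image.1 h1
        simp only [Finset.mem_product, Prod.ext_iff] at hz h
        exact hw.2.1.1 (h.2.1 ▸ hz.1.1)
      · obtain ⟨z, hz, h⟩ := Finset.mem_image.1 h1
        simp only [Finset.mem_product, mE, Prod.ext_iff] at hz h
        exact hz.2.1.2 (h.1.2 ▸ hw.1)
    have hsub : T₁ ∪ T₂ ∪ T₃ ⊆ T := by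
      intro p hp
      simp only [T, Finset.mem_filter, mem_badPairs]
      rcases Finset.mem_union.1 hp with hp | hp
      · rcases Finset.mem_union.1 hp with hp | hp
        · obtain ⟨⟨⟨u, a⟩, ⟨v, b⟩⟩, hz, rfl⟩ := Finset.mem_image.1 hp
          simp only [Finset.mem_product, mX, mY, mK] at hz
          obtain ⟨⟨h1, h2⟩, h3⟩ := hz
          exact ⟨⟨h2 v, h1 b, fun h => h3 h.1⟩, h1 a, h3⟩
        · obtain ⟨⟨u, ⟨v, a⟩⟩, hz, rfl⟩ := Finset.mem_image.1 hp
          simp only [Finset.mem_product, mX u, mE] at hz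
          obtain ⟨h1, ⟨h2, -⟩, h3⟩ := hz
          exact ⟨⟨h3, h1 _, fun h => hβ v h2 h.1⟩, h1 a, hβ v h2⟩
      · obtain ⟨⟨a, ⟨u, b⟩⟩, hz, rfl⟩ := Finset.mem_image.1 hp
        simp only [Finset.mem_product, mY a, mE] at hz
        obtain ⟨h1, ⟨-, h2⟩, h3⟩ := hz
        exact ⟨⟨h1 _, h3, fun h => hα b h2 h.1⟩, h1 u, hα b h2⟩
    have := Finset.card_le_card hsub
    rw [Finset.card_union_of_disjoint d₁₂₃, Finset.card_union_of_disjoint d₁₂, c₁, c₂, c₃] at this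
    nlinarith

/-- Here `p`, `q` count the dominating vertices on the two sides, `m`, `n` the others, `k` the
non-edges and `r` the edges between non-dominating vertices, so `e = pq + pn + qm + r`. The three
exceptional cases are the shapes of `K⁻` and of the two orientations of `K⁺`. -/
theorem bad_arith {p q m n k r e N : ℕ} (hp : 1 ≤ p) (hq : 1 ≤ q) (hm : 1 ≤ m) (hn : 1 ≤ n)
    (he : e + k = (p + m) * (q + n)) (hr : r + k = m * n) (hkm : m ≤ k) (hkn : n ≤ k)
    (hN : 2 * (p * q * k + (p + q) * r) ≤ N) :
    (m = 1 ∧ n = 1) ∨ (n = 1 ∧ p = 1) ∨ (m = 1 ∧ q = 1) ∨ 2 * e ≤ N + 4 := by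
  have he' : e = p * q + p * n + q * m + r := by nlinarith
  suffices (m = 1 ∧ n = 1) ∨ (n = 1 ∧ p = 1) ∨ (m = 1 ∧ q = 1) ∨
      e ≤ p * q * k + (p + q) * r + 2 by omega
  clear hN he
  subst he'
  rcases Nat.lt_or_ge 1 m with hm2 | hm1
  · rcases Nat.lt_or_ge 1 n with hn2 | hn1
    · right; right; right
      obtain ⟨p, rfl⟩ := Nat.exists_eq_add_of_le hp
      obtain ⟨q, rfl⟩ := Nat.exists_eq_add_of_le hq
      obtain ⟨m, rfl⟩ := Nat.exists_eq_add_of_le hm2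
      obtain ⟨n, rfl⟩ := Nat.exists_eq_add_of_le hn2
      obtain ⟨k, rfl⟩ := Nat.exists_eq_add_of_le (hm.trans hkm)
      have hr' : r = 3 + 2 * m + 2 * n + m * n - k := by
        ring_nf at hr ⊢
        omega
      have hk : k ≤ 3 + 2 * m + 2 * n + m * n := by
        ring_nf at hr ⊢
        omega
      obtain ⟨l, hl⟩ := Nat.exists_eq_add_of_le hk
      obtain rfl : r = l := by omega
      nlinarith [Nat.zero_le (p * q * k), congrArg (fun z => p * z) hl,
        congrArg (fun z => q * z) hl, Nat.zero_le (p * m), Nat.zero_le (p * n),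
        Nat.zero_le (q * m), Nat.zero_le (q * n), Nat.zero_le (p * (m * n)),
        Nat.zero_le (q * (m * n)), Nat.zero_le (m * n), Nat.zero_le (p * q * r)]
    · obtain rfl : n = 1 := by omega
      -- The single non-dominating vertex on the other side is missed by all `m` non-dominating
      -- vertices, which leaves no edge among them.
      obtain ⟨rfl, rfl⟩ : k = m ∧ r = 0 := by omega
      rcases Nat.lt_or_ge 1 p with hp2 | hp1
      · right; right; right
        obtain ⟨p, rfl⟩ := Nat.exists_eq_add_of_le hp2
        obtain ⟨q, rfl⟩ := Nat.exists_eq_add_of_le hq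
        obtain ⟨m, rfl⟩ := Nat.exists_eq_add_of_le hm2
        ring_nf
        nlinarith [Nat.zero_le (p * q * m), Nat.zero_le (p * q), Nat.zero_le (p * m), Nat.zero_le (q * m)]
      · omega
  · obtain rfl : m = 1 := by omega
    rcases Nat.lt_or_ge 1 n with hn2 | hn1
    · obtain ⟨rfl, rfl⟩ : k = n ∧ r = 0 := by omega
      rcases Nat.lt_or_ge 1 q with hp2 | hp1
      · right; right; right
        obtain ⟨q, rfl⟩ := Nat.exists_eq_add_of_le hp2
        obtain ⟨p, rfl⟩ := Nat.exists_eq_add_of_le hp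
        obtain ⟨n, rfl⟩ := Nat.exists_eq_add_of_le hn2
        ring_nf
        nlinarith [Nat.zero_le (p * q * n), Nat.zero_le (p * q), Nat.zero_le (p * n), Nat.zero_le (q * n)]
      · omega
    · omega

/-- A bipartite graph without isolated vertices with few bad pairs is complete bipartite, or one of
the graphs `K⁻`, `K⁺`. -/
theorem few_badPairs_classification (hX : ∀ x, ∃ y, R x y) (hY : ∀ y, ∃ x, R x y)
    (hN : (badPairs R).card + 4 < 2 * (biEdges R).card) :
    (∀ x y, R x y) ∨ (∃ x₀ y₀, ∀ x y, R x y ↔ ¬ (x = x₀ ∧ y = y₀)) ∨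
      (∃ x₀ y₀, ∀ x y, R x y ↔ (y ≠ y₀ ∨ x = x₀)) ∨
      (∃ x₀ y₀, ∀ x y, R x y ↔ (x ≠ x₀ ∨ y = y₀)) := by
  classical
  by_cases hcomplete : ∀ x y, R x y
  · exact Or.inl hcomplete
  right
  by_cases hdom : ∀ x y, R x y → ∃ x' y', R x' y' ∧ ¬ (R x y' ∧ R x' y)
  · have := card_badPairs_of_no_dominating_edge hX hY hdom
    omega
  push Not at hdom hcomplete
  obtain ⟨u, a, hua, hdom⟩ := hdom
  obtain ⟨v, b, hvb⟩ := hcomplete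
  have : Nonempty X := ⟨u⟩
  have : Nonempty Y := ⟨a⟩
  obtain ⟨k, r, he, hr, hk1, hk2, hk⟩ := card_badPairs_dominating (R := R)
  set X₀ : Finset X := Finset.univ.filter fun x => ∀ y, R x y with hX₀
  set Y₀ : Finset Y := Finset.univ.filter fun y => ∀ x, R x y with hY₀
  have mX : ∀ x, x ∈ X₀ ↔ ∀ y, R x y := by simp [X₀]
  have mY : ∀ y, y ∈ Y₀ ↔ ∀ x, R x y := by simp [Y₀]
  -- As no vertex is isolated, both ends of an edge without bad partners are dominating.
  have hu : u ∈ X₀ := (mX u).2 fun y => by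
    obtain ⟨x, hx⟩ := hY y
    exact (hdom x y hx).1
  have ha : a ∈ Y₀ := (mY a).2 fun x => by
    obtain ⟨y, hy⟩ := hX x
    exact (hdom x y hy).2
  have hv : v ∈ X₀ᶜ := by
    simp only [Finset.mem_compl, mX]
    exact fun h => hvb (h b)
  have hb : b ∈ Y₀ᶜ := by
    simp only [Finset.mem_compl, mY]
    exact fun h => hvb (h v)
  rw [← Finset.card_add_card_compl X₀, ← Finset.card_add_card_compl Y₀] at he
  rcases bad_arith (Finset.card_pos.2 ⟨u, hu⟩) (Finset.card_pos.2 ⟨a, ha⟩)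
    (Finset.card_pos.2 ⟨v, hv⟩) (Finset.card_pos.2 ⟨b, hb⟩) he hr hk1 hk2 hk with h | h | h | h
  · left
    have h1 := fun x hx => Finset.card_le_one.1 h.1.le x hx v hv
    have h2 := fun y hy => Finset.card_le_one.1 h.2.le y hy b hb
    simp only [Finset.mem_compl, mX, mY] at h1 h2
    refine ⟨v, b, fun x y => ⟨?_, fun hxy => ?_⟩⟩
    · rintro hxy ⟨rfl, rfl⟩
      exact hvb hxy
    · by_contra hn
      exact hxy ⟨h1 x fun h => hn (h y), h2 y fun h => hn (h x)⟩
  · right; left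
    have h1 := fun x hx => Finset.card_le_one.1 h.2.le x hx u hu
    have h2 := fun y hy => Finset.card_le_one.1 h.1.le y hy b hb
    simp only [Finset.mem_compl, mX, mY] at h1 h2 hu
    refine ⟨u, b, fun x y => ⟨fun hxy => ?_, ?_⟩⟩
    · by_contra! hn
      obtain ⟨rfl, hn⟩ := hn
      refine hn (h1 x fun z => ?_)
      by_contra hz
      exact hz (h2 z (fun h => hz (h x)) ▸ hxy)
    · rintro (hy | rfl)
      · by_contra hxy
        exact hy (h2 y fun h => hxy (h x))
      · exact hu y
  · right; right
    have h1 := fun y hy => Finset.card_le_one.1 h.2.le y hy a ha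
    have h2 := fun x hx => Finset.card_le_one.1 h.1.le x hx v hv
    simp only [Finset.mem_compl, mX, mY] at h1 h2 ha
    refine ⟨v, a, fun x y => ⟨fun hxy => ?_, ?_⟩⟩
    · by_contra! hn
      obtain ⟨rfl, hn⟩ := hn
      refine hn (h1 y fun z => ?_)
      by_contra hz
      exact hz (h2 z (fun h => hz (h y)) ▸ hxy)
    · rintro (hx | rfl)
      · by_contra hxy
        exact hx (h2 x fun h => hxy (h y))
      · exact ha x
  · omega

/-! ### Exact counts for `K⁻` and `K⁺`. -/

/-- In both `K⁻` and `K⁺` the unordered bad pairs are parametrised by the `(x, y)` with `x ≠ x₀` and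
`y ≠ y₀`; `f` selects one orientation of each. -/
theorem card_badPairs_eq_of_injective {f : X × Y → (X × Y) × (X × Y)} (hf : f.Injective)
    (x₀ : X) (y₀ : Y)
    (hswap : ∀ x y x' y', x ≠ x₀ → y ≠ y₀ → x' ≠ x₀ → y' ≠ y₀ → f (x', y') ≠ (f (x, y)).swap)
    (hbad : ∀ x y, x ≠ x₀ → y ≠ y₀ → f (x, y) ∈ badPairs R)
    (hall : ∀ p ∈ badPairs R, ∃ x y, x ≠ x₀ ∧ y ≠ y₀ ∧ (f (x, y) = p ∨ f (x, y) = p.swap)) :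
    (badPairs R).card = 2 * ((Fintype.card X - 1) * (Fintype.card Y - 1)) := by
  classical
  let T := ((Finset.univ.erase x₀) ×ˢ (Finset.univ.erase y₀)).image f
  have mT : ∀ p, p ∈ T ↔ ∃ x y, (x ≠ x₀ ∧ y ≠ y₀) ∧ f (x, y) = p := by simp [T]
  have hc : T.card = (Fintype.card X - 1) * (Fintype.card Y - 1) := by
    rw [Finset.card_image_of_injective _ hf, Finset.card_product,
      Finset.card_erase_of_mem (Finset.mem_univ _), Finset.card_erase_of_mem (Finset.mem_univ _),
      Finset.card_univ, Finset.card_univ]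
  rw [← hc]
  apply le_antisymm
  · refine badPairs_card_le_two_mul fun p hp => ?_
    obtain ⟨x, y, hx, hy, h | h⟩ := hall p hp
    · exact Or.inl ((mT _).2 ⟨x, y, ⟨hx, hy⟩, h⟩)
    · exact Or.inr ((mT _).2 ⟨x, y, ⟨hx, hy⟩, h⟩)
  · refine two_mul_card_le_badPairs (fun p hp => ?_) fun p hp hp' => ?_
    · obtain ⟨x, y, ⟨hx, hy⟩, rfl⟩ := (mT _).1 hp
      exact hbad x y hx hy
    · obtain ⟨x, y, ⟨hx, hy⟩, rfl⟩ := (mT _).1 hp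
      obtain ⟨x', y', ⟨hx', hy'⟩, h⟩ := (mT _).1 hp'
      exact hswap x y x' y' hx hy hx' hy' h

theorem card_of_kMinus {x₀ : X} {y₀ : Y} (h : ∀ x y, R x y ↔ ¬ (x = x₀ ∧ y = y₀)) :
    (biEdges R).card + 1 = Fintype.card X * Fintype.card Y ∧
      (badPairs R).card = 2 * ((Fintype.card X - 1) * (Fintype.card Y - 1)) := by
  classical
  constructor
  · have : biEdges R = Finset.univ.erase (x₀, y₀) := by
      ext ⟨x, y⟩; simp [h]
    rw [this, Finset.card_erase_add_one (Finset.mem_univ _), Finset.card_univ, Fintype.card_prod]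
  · refine card_badPairs_eq_of_injective (f := fun q => ((x₀, q.2), (q.1, y₀))) ?_ x₀ y₀ ?_ ?_ ?_
    · rintro ⟨_, _⟩ ⟨_, _⟩ hq
      simp at hq ⊢; tauto
    · intro x y x' y' hx hy hx' hy' hq
      simp at hq
      exact hx hq.1.1.symm
    · intro x y hx hy
      simp [h, hx, hy]
    · rintro ⟨⟨x, y⟩, ⟨x', y'⟩⟩ hp
      simp only [mem_badPairs, h] at hp
      by_cases h1 : x = x₀ ∧ y' = y₀
      · obtain ⟨rfl, rfl⟩ := h1
        exact ⟨x', y, by tauto, by tauto, Or.inl rfl⟩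
      · obtain ⟨rfl, rfl⟩ : x' = x₀ ∧ y = y₀ := by tauto
        exact ⟨x, y', by tauto, by tauto, Or.inr rfl⟩

theorem card_of_kPlus {x₀ : X} {y₀ : Y} (h : ∀ x y, R x y ↔ (y ≠ y₀ ∨ x = x₀)) :
    (biEdges R).card = Fintype.card X * (Fintype.card Y - 1) + 1 ∧
      (badPairs R).card = 2 * ((Fintype.card X - 1) * (Fintype.card Y - 1)) := by
  classical
  constructor
  · have : biEdges R = insert (x₀, y₀) (Finset.univ ×ˢ Finset.univ.erase y₀) := by
      ext ⟨x, y⟩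
      simp [h]
      by_cases hy : y = y₀ <;> simp [hy]
    rw [this, Finset.card_insert_of_notMem (by simp), Finset.card_product, Finset.card_univ,
      Finset.card_erase_of_mem (Finset.mem_univ _), Finset.card_univ]
  · refine card_badPairs_eq_of_injective (f := fun q => (q, (x₀, y₀))) ?_ x₀ y₀ ?_ ?_ ?_
    · rintro ⟨_, _⟩ ⟨_, _⟩ hq
      simp at hq ⊢; tauto
    · intro x y x' y' hx hy hx' hy' hq
      simp at hq
      exact hx' hq.1.1
    · intro x y hx hy
      simp [h, hx, hy]
    · rintro ⟨⟨x, y⟩, ⟨x', y'⟩⟩ hp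
      simp only [mem_badPairs, h] at hp
      by_cases h1 : y' = y₀ ∧ x ≠ x₀
      · obtain ⟨rfl, h1⟩ := h1
        obtain rfl : x' = x₀ := by tauto
        exact ⟨x, y, by tauto, by tauto, Or.inl rfl⟩
      · obtain ⟨rfl, h2⟩ : y = y₀ ∧ x' ≠ x₀ := by tauto
        obtain rfl : x = x₀ := by tauto
        exact ⟨x', y', by tauto, by tauto, Or.inr rfl⟩

end

/-! ### Passing between abstract bipartite graphs and relations. -/

/-- A bipartite graph is isomorphic to the graph of its biadjacency relation. -/
theorem SimpleGraph.IsBipartite.exists_iso_bipGraph {V : Type*} [Fintype V] {G : SimpleGraph V}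
    (h : G.IsBipartite) : ∃ (s : Set V),
      Nonempty (G ≃g bipGraph fun (x : s) (y : (sᶜ : Set V)) => G.Adj x y) := by
  classical
  obtain ⟨c⟩ := h
  let s : Set V := {v | c v = 0}
  refine ⟨s, ⟨SimpleGraph.Iso.symm ⟨Equiv.Set.sumCompl s, ?_⟩⟩⟩
  have h1 : ∀ x ∈ sᶜ, c x = 1 := fun x hx => by
    have : c x ≠ 0 := hx
    omega
  rintro (⟨x, hx⟩ | ⟨x, hx⟩) (⟨y, hy⟩ | ⟨y, hy⟩)
  · simpa using fun h => c.valid h (hx.trans hy.symm)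
  · simp
  · simp [G.adj_comm]
  · simpa using fun h => c.valid h ((h1 x hx).trans (h1 y hy).symm)

theorem SimpleGraph.Iso.ncard_edgeSet_eq {V W : Type*} {G : SimpleGraph V} {H : SimpleGraph W}
    (f : G ≃g H) : G.edgeSet.ncard = H.edgeSet.ncard :=
  Nat.card_congr f.mapEdgeSet

theorem SimpleGraph.Iso.isCompleteBipartiteWithIsolated {V W : Type*} {G : SimpleGraph V}
    {H : SimpleGraph W} (f : G ≃g H) (h : H.IsCompleteBipartiteWithIsolated) :
    G.IsCompleteBipartiteWithIsolated := by
  obtain ⟨A, B, hd, hA⟩ := h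
  refine ⟨f ⁻¹' A, f ⁻¹' B, hd.preimage f, fun u v => ?_⟩
  rw [← f.map_adj_iff, hA]
  rfl

section
variable {X Y : Type*} {R : X → Y → Prop}

theorem bipGraph_isBipartite : (bipGraph R).IsBipartite := by
  refine ⟨SimpleGraph.Coloring.mk (fun v => if v.isLeft then 0 else 1) ?_⟩
  rintro (u | u) (v | v) h
  · exact h.elim
  · simp
  · simp
  · exact h.elim

/-- The bipartite graph of the transposed relation. -/
def bipGraphFlip : bipGraph R ≃g bipGraph (flip R) where
  toEquiv := Equiv.sumComm X Y
  map_rel_iff' := by rintro (u | u) (v | v) <;> simp [flip]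

theorem not_isCompleteBipartiteWithIsolated [Fintype X] [Fintype Y]
    (h : (badPairs R).Nonempty) : ¬ (bipGraph R).IsCompleteBipartiteWithIsolated := by
  rintro ⟨A, B, -, hA⟩
  obtain ⟨⟨⟨x, y⟩, ⟨x', y'⟩⟩, hp⟩ := h
  simp only [mem_badPairs] at hp
  have h1 := hA (.inl x) (.inr y)
  have h2 := hA (.inl x') (.inr y')
  have h3 := hA (.inl x) (.inr y')
  have h4 := hA (.inl x') (.inr y)
  have h5 := hA (.inl x) (.inl x')
  have h6 := hA (.inr y) (.inr y')
  simp only [bipGraph_adj_inl_inr, bipGraph_adj_inl_inl, bipGraph_adj_inr_inr] at h1 h2 h3 h4 h5 h6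
  obtain ⟨e1, e2, e3⟩ := hp
  rcases h1.1 e1 with a | a <;> rcases h2.1 e2 with b | b
  · exact e3 ⟨h3.2 (Or.inl ⟨a.1, b.2⟩), h4.2 (Or.inl ⟨b.1, a.2⟩)⟩
  · exact h5.2 (Or.inl ⟨a.1, b.1⟩)
  · exact h5.2 (Or.inr ⟨a.1, b.1⟩)
  · exact e3 ⟨h3.2 (Or.inr ⟨a.1, b.2⟩), h4.2 (Or.inr ⟨b.1, a.2⟩)⟩

theorem badPairs_nonempty [Fintype X] [Fintype Y]
    (h : ¬ (bipGraph R).IsCompleteBipartiteWithIsolated) : (badPairs R).Nonempty := by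
  by_contra hn
  rw [Finset.not_nonempty_iff_eq_empty] at hn
  have key : ∀ x y x' y', R x y → R x' y' → R x y' := by
    intro x y x' y' h1 h2
    by_contra h3
    have : ((x, y), (x', y')) ∈ badPairs R := by simp [h1, h2, h3]
    simp [hn] at this
  refine h ⟨Sum.inl '' {x | ∃ y, R x y}, Sum.inr '' {y | ∃ x, R x y}, ?_, ?_⟩
  · rw [Set.disjoint_left]
    rintro _ ⟨x, -, rfl⟩ ⟨y, -, h⟩
    cases h
  · rintro (x | y) (x' | y')
    · simp
    · simp only [bipGraph_adj_inl_inr, Set.mem_image, Set.mem_ofPred_eq]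
      constructor
      · exact fun h => Or.inl ⟨⟨x, ⟨_, h⟩, rfl⟩, ⟨y', ⟨_, h⟩, rfl⟩⟩
      · rintro (⟨⟨a, ⟨b, hab⟩, ha⟩, ⟨c, ⟨d, hcd⟩, hc⟩⟩ | ⟨⟨_, _, h⟩, _⟩)
        · cases ha; cases hc
          exact key _ _ _ _ hab hcd
        · cases h
    · simp only [bipGraph_adj_inr_inl, Set.mem_image, Set.mem_ofPred_eq]
      constructor
      · exact fun h => Or.inr ⟨⟨y, ⟨_, h⟩, rfl⟩, ⟨x', ⟨_, h⟩, rfl⟩⟩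
      · rintro (⟨⟨_, _, h⟩, _⟩ | ⟨⟨c, ⟨d, hcd⟩, hc⟩, ⟨a, ⟨b, hab⟩, ha⟩⟩)
        · cases h
        · cases ha; cases hc
          exact key _ _ _ _ hab hcd
    · simp

theorem ncard_edgeSet_bipGraph [Fintype X] [Fintype Y] :
    (bipGraph R).edgeSet.ncard = (biEdges R).card := by
  classical
  have hinj : Function.Injective fun p : X × Y => s((Sum.inl p.1 : X ⊕ Y), Sum.inr p.2) := by
    rintro ⟨x, y⟩ ⟨x', y'⟩ h
    simpa using h
  rw [← Set.ncard_coe_finset, ← Set.ncard_image_of_injective _ hinj]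
  congr 1
  ext z
  induction z with | _ u v
  rw [SimpleGraph.mem_edgeSet]
  rcases u with x | y <;> rcases v with x' | y' <;> simp

/-- The bipartite graph of a relation that fails in one place only is some `K⁻`. -/
theorem isKMinus_of_iso {V : Type*} [Fintype X] [Fintype Y] {G : SimpleGraph V}
    (f : G ≃g bipGraph R) {x₀ : X} {y₀ : Y} (h : ∀ x y, R x y ↔ ¬ (x = x₀ ∧ y = y₀)) :
    G.IsKMinus (Fintype.card X) (Fintype.card Y) := by
  let α := Fintype.equivFin X
  let β := Fintype.equivFin Y
  refine ⟨α x₀, β y₀, ⟨f.trans ⟨Equiv.sumCongr α β, ?_⟩⟩⟩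
  rintro (x | y) (x' | y')
  · simp
  · simp [h]
  · simp only [Equiv.sumCongr_apply]
    simp [h]
    tauto
  · simp

theorem isKMinus_of_iso' {V : Type*} [Fintype X] [Fintype Y] {G : SimpleGraph V}
    (f : G ≃g bipGraph R) {x₀ : X} {y₀ : Y} (h : ∀ x y, R x y ↔ ¬ (x = x₀ ∧ y = y₀)) :
    G.IsKMinus (Fintype.card Y) (Fintype.card X) :=
  isKMinus_of_iso (f.trans bipGraphFlip) (x₀ := y₀) (y₀ := x₀) fun x y => by
    rw [flip, h, and_comm]

/-- The bipartite graph of a relation that is full except for a vertex of degree one is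
some `K⁺`. -/
theorem isKPlus_of_iso {V : Type*} [Fintype X] [Fintype Y] {G : SimpleGraph V}
    (f : G ≃g bipGraph R) {x₀ : X} {y₀ : Y} (h : ∀ x y, R x y ↔ (y ≠ y₀ ∨ x = x₀)) :
    G.IsKPlus (Fintype.card X) (Fintype.card Y - 1) := by
  classical
  let α := Fintype.equivFin X
  have hc : Fintype.card {y : Y // y ≠ y₀} = Fintype.card Y - 1 := by
    simp
  let β : {y : Y // y ≠ y₀} ≃ Fin (Fintype.card Y - 1) := Fintype.equivFinOfCardEq hc
  let g : X ⊕ Y → Option (Fin (Fintype.card X) ⊕ Fin (Fintype.card Y - 1)) := fun v =>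
    match v with
    | .inl x => some (.inl (α x))
    | .inr y => if hy : y = y₀ then none else some (.inr (β ⟨y, hy⟩))
  have hg : Function.Bijective g := by
    constructor
    · rintro (x | y) (x' | y') hxy
      · simpa [g] using hxy
      · by_cases hy : y' = y₀ <;> simp [g, hy] at hxy
      · by_cases hy : y = y₀ <;> simp [g, hy] at hxy
      · by_cases hy : y = y₀ <;> by_cases hy' : y' = y₀ <;> simp [g, hy, hy'] at hxy ⊢
        exact hxy
    · rintro (_ | x | y)
      · exact ⟨.inr y₀, by simp [g]⟩
      · exact ⟨.inl (α.symm x), by simp [g]⟩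
      · exact ⟨.inr (β.symm y).1, by simp [g, (β.symm y).2]⟩
  refine ⟨α x₀, ⟨f.trans ⟨Equiv.ofBijective g hg, ?_⟩⟩⟩
  rintro (x | y) (x' | y')
  · simp [g, SimpleGraph.edge_adj, SimpleGraph.map_adj']
  · by_cases hy : y' = y₀ <;> simp [g, h, hy, SimpleGraph.edge_adj, SimpleGraph.map_adj']
  · by_cases hy : y = y₀ <;> simp [g, h, hy, SimpleGraph.edge_adj, SimpleGraph.map_adj']
  · by_cases hy : y = y₀ <;> by_cases hy' : y' = y₀ <;> simp [g, hy, hy', SimpleGraph.edge_adj, SimpleGraph.map_adj']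

end

/-! ### Comparing an extremal graph with a competitor. -/

/-- All radii in question are bounded away from `√e`. -/
theorem pow_four_le_of_mem_nonCompleteBipartiteRadii {e : ℕ} (he : 0 < e) {r : ℝ}
    (hr : r ∈ nonCompleteBipartiteRadii e) : 0 ≤ r ∧ r ^ 2 ≤ e ∧ r ^ 4 ≤ (e : ℝ) ^ 2 - 1 := by
  classical
  obtain ⟨n, H, hb, hc, hn, rfl⟩ := hr
  obtain ⟨s, ⟨f⟩⟩ := hb.exists_iso_bipGraph
  have hE := f.ncard_edgeSet_eq
  rw [hc, ncard_edgeSet_bipGraph] at hE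
  have hN := badPairs_nonempty fun h => hn (f.isCompleteBipartiteWithIsolated h)
  rw [f.largestEigenvalue_eq]
  obtain ⟨h0, h1, h2, -⟩ := bipGraph_spectral _ (hE ▸ he)
  rw [← hE] at h1 h2
  have : (1 : ℝ) ≤ (badPairs fun (x : s) (y : (sᶜ : Set (Fin n))) => H.Adj x y).card := by
    exact_mod_cast Finset.card_pos.2 hN
  exact ⟨h0, h1, by linarith⟩

theorem largestEigenvalue_mem_nonCompleteBipartiteRadii {X Y : Type*} [Fintype X] [Fintype Y]
    {R : X → Y → Prop} (h : (badPairs R).Nonempty) :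
    (bipGraph R).largestEigenvalue ∈ nonCompleteBipartiteRadii (biEdges R).card := by
  let f : bipGraph R ≃g (bipGraph R).map (Fintype.equivFin (X ⊕ Y)).toEmbedding :=
    SimpleGraph.Iso.map (Fintype.equivFin (X ⊕ Y)) _
  refine ⟨_, _, ?_, ?_, fun hc => ?_, f.largestEigenvalue_eq⟩
  · obtain ⟨c⟩ := bipGraph_isBipartite (R := R)
    exact ⟨c.comp f.symm.toHom⟩
  · rw [← f.ncard_edgeSet_eq, ncard_edgeSet_bipGraph]
  · exact not_isCompleteBipartiteWithIsolated h (f.isCompleteBipartiteWithIsolated hc)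

/-- A graph of maximal spectral radius has at most as many bad pairs as any competitor,
up to one. -/
theorem card_badPairs_le_of_max {X Y X' Y' : Type*} [Fintype X] [Fintype Y] [Fintype X']
    [Fintype Y'] {R : X → Y → Prop} {Q : X' → Y' → Prop} {e D : ℕ} (he : 4 ≤ e)
    (hR : (biEdges R).card = e) (hQ : (biEdges Q).card = e) (hQN : (badPairs Q).card = 2 * D)
    (hD : 0 < D) (hDe : D + 3 ≤ e)
    (hmax : (bipGraph R).largestEigenvalue = maxNonCompleteBipartiteRadius e) :
    0 < (badPairs R).card ∧ (badPairs R).card ≤ 2 * D + 1 := by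
  have hQne : (badPairs Q).Nonempty := Finset.card_pos.1 (by omega)
  have hmem := largestEigenvalue_mem_nonCompleteBipartiteRadii hQne
  rw [hQ] at hmem
  have hbound := fun r hr => pow_four_le_of_mem_nonCompleteBipartiteRadii
    (e := e) (r := r) (by omega) hr
  have hbdd : BddAbove (nonCompleteBipartiteRadii e) := by
    refine ⟨Real.sqrt e, fun r hr => Real.le_sqrt_of_sq_le (hbound r hr).2.1⟩
  have hle : (bipGraph Q).largestEigenvalue ≤ (bipGraph R).largestEigenvalue := by
    rw [hmax]
    exact le_csSup hbdd hmem
  obtain ⟨r0, -, r2, r3, -⟩ := bipGraph_spectral R (by omega)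
  obtain ⟨q0, -, q2, q3, q4⟩ := bipGraph_spectral Q (by omega)
  rw [hR] at r2 r3
  rw [hQ, hQN] at q2 q3 q4
  constructor
  -- Without bad pairs `H = e²`, so `H ≤ e ρ²` gives `ρ² ≥ e`; but the fourth powers of all
  -- competing radii, and hence of their supremum, are at most `e² - 1`.
  · by_contra hz
    have hz : (badPairs R).card = 0 := by omega
    have hE : (4 : ℝ) ≤ e := by exact_mod_cast he
    have hup : (bipGraph R).largestEigenvalue ≤ Real.sqrt (Real.sqrt ((e : ℝ) ^ 2 - 1)) := by
      rw [hmax]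
      refine csSup_le ⟨_, hmem⟩ fun r hr => Real.le_sqrt_of_sq_le (Real.le_sqrt_of_sq_le ?_)
      have := (hbound r hr).2.2
      linarith [show (r ^ 2) ^ 2 = r ^ 4 by ring]
    have h4 : (bipGraph R).largestEigenvalue ^ 4 ≤ (e : ℝ) ^ 2 - 1 := by
      refine (pow_le_pow_left₀ r0 hup 4).trans (le_of_eq ?_)
      rw [show ∀ x : ℝ, x ^ 4 = (x ^ 2) ^ 2 from fun x => by ring, Real.sq_sqrt (Real.sqrt_nonneg _),
        Real.sq_sqrt (by nlinarith)]
    rw [hz] at r3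
    have : (e : ℝ) ≤ (bipGraph R).largestEigenvalue ^ 2 := by
      push_cast at r3
      nlinarith
    nlinarith
  · set L := (bipGraph Q).largestEigenvalue ^ 2 with hL
    have hLL : (bipGraph Q).largestEigenvalue ^ 4 = L ^ 2 := by rw [hL]; ring
    have h4 : L ^ 2 ≤ (bipGraph R).largestEigenvalue ^ 4 := by
      rw [← hLL]
      exact pow_le_pow_left₀ q0 hle 4
    rw [hLL] at q2 q4
    have hE : (4 : ℝ) ≤ e := by exact_mod_cast he
    have hD' : (D : ℝ) + 3 ≤ e := by exact_mod_cast hDe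
    push_cast at q2 q3 q4
    clear_value L
    -- `δ` is the defect of the competitor's `ρ²` from `e`. The bound `H ≤ e ρ²` reads `eδ ≤ 2D ≤ 2e
    -- - 6`, so `δ < 2`. The bound `q4` reads `2eδ - 3δ² ≤ 2D`, which fails throughout `1 ≤ δ ≤ 2`,
    -- so `δ < 1`.
    obtain ⟨δ, hδ⟩ : ∃ δ, δ = (e : ℝ) - L := ⟨_, rfl⟩
    obtain rfl : L = e - δ := by linarith
    have h2 : δ < 2 := by
      by_contra! hge
      nlinarith
    have h1 : δ < 1 := by
      by_contra! hge
      nlinarith [mul_nonneg (sub_nonneg.2 hge) (sub_nonneg.2 h2.le)]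
    -- `N ≤ e² - L² = 2eδ - δ² ≤ 2D + 2δ²`, with `δ < 1`; nonnegativity of `δ` comes from `q2`.
    have : ((badPairs R).card : ℝ) < 2 * D + 2 := by nlinarith
    have : (badPairs R).card < 2 * D + 2 := by exact_mod_cast this
    omega

/-- The degenerate values of `s` and `t` are excluded by the bounds on `N`: `s = 1` gives `N = 0`,
and `t = 1` gives `N + 4 = 2e`. The last clause records that `K⁺_{2,t}` is the same graph as
`K⁻_{2,t+1}`, the pendant edge being what is left when one of two edges is deleted. -/
theorem extremal_kPlus_shape {V X Y : Type*} [Fintype X] [Fintype Y] {G : SimpleGraph V}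
    {R : X → Y → Prop} (f : G ≃g bipGraph R) {x₀ : X} {y₀ : Y}
    (h : ∀ x y, R x y ↔ (y ≠ y₀ ∨ x = x₀)) (hpos : 0 < (badPairs R).card)
    (hN : (badPairs R).card + 4 < 2 * (biEdges R).card) :
    ∃ s t, 2 ≤ s ∧ 2 ≤ t ∧ s * t + 1 = (biEdges R).card ∧
      (badPairs R).card = 2 * ((s - 1) * t) ∧ G.IsKPlus s t ∧ (s = 2 → G.IsKMinus 2 (t + 1)) := by
  classical
  obtain ⟨hE, hB⟩ := card_of_kPlus h
  have hs : 2 ≤ Fintype.card X := by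
    by_contra! hlt
    rw [hB, show Fintype.card X - 1 = 0 by omega] at hpos
    simp at hpos
  have ht : 2 ≤ Fintype.card Y - 1 := by
    by_contra! hlt
    obtain ⟨s, hs'⟩ := Nat.exists_eq_add_of_le hs
    rw [hB, hE, hs'] at hN
    interval_cases (Fintype.card Y - 1) <;> omega
  refine ⟨_, _, hs, ht, hE.symm, hB, isKPlus_of_iso f h, fun h2 => ?_⟩
  obtain ⟨x₁, hx₁, huniq⟩ : ∃ x₁ : X, x₁ ≠ x₀ ∧ ∀ x, x ≠ x₀ → x = x₁ := by
    have hc : (Finset.univ.erase x₀).card = 1 := by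
      rw [Finset.card_erase_of_mem (Finset.mem_univ _), Finset.card_univ, h2]
    obtain ⟨x₁, hx₁⟩ := Finset.card_eq_one.1 hc
    have hm : ∀ x, x ≠ x₀ ↔ x = x₁ := fun x => by
      simpa using Finset.ext_iff.1 hx₁ x
    exact ⟨x₁, (hm x₁).2 rfl, fun x => (hm x).1⟩
  have hK := isKMinus_of_iso f (x₀ := x₁) (y₀ := y₀) fun x y => by
    rw [h]
    constructor
    · rintro (hy | rfl) ⟨rfl, rfl⟩
      · exact hy rfl
      · exact hx₁ rfl
    · intro hxy
      by_contra! hn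
      exact hxy ⟨huniq x hn.2, hn.1⟩
  rwa [h2, show Fintype.card Y = Fintype.card Y - 1 + 1 by omega] at hK

/-- A bipartite graph with few bad pairs that is not complete bipartite is some `K⁻` or `K⁺`. -/
theorem extremal_shape {V X Y : Type*} [Fintype X] [Fintype Y] {G : SimpleGraph V}
    {R : X → Y → Prop} (f : G ≃g bipGraph R) (hX : ∀ x, ∃ y, R x y) (hY : ∀ y, ∃ x, R x y)
    (hpos : 0 < (badPairs R).card) (hN : (badPairs R).card + 4 < 2 * (biEdges R).card) :
    (∃ s t, 2 ≤ s ∧ 2 ≤ t ∧ s * t = (biEdges R).card + 1 ∧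
      (badPairs R).card = 2 * ((s - 1) * (t - 1)) ∧ G.IsKMinus s t ∧ G.IsKMinus t s) ∨
    (∃ s t, 2 ≤ s ∧ 2 ≤ t ∧ s * t + 1 = (biEdges R).card ∧
      (badPairs R).card = 2 * ((s - 1) * t) ∧ G.IsKPlus s t ∧
      (s = 2 → G.IsKMinus 2 (t + 1))) := by
  rcases few_badPairs_classification hX hY hN with h | ⟨x₀, y₀, h⟩ | ⟨x₀, y₀, h⟩ | ⟨x₀, y₀, h⟩
  · obtain ⟨p, hp⟩ := Finset.card_pos.1 hpos
    simp [h] at hp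
  · left
    obtain ⟨hE, hB⟩ := card_of_kMinus h
    have hs : 2 ≤ Fintype.card X ∧ 2 ≤ Fintype.card Y := by
      constructor <;> by_contra! hlt
      · rw [hB, show Fintype.card X - 1 = 0 by omega] at hpos
        simp at hpos
      · rw [hB, show Fintype.card Y - 1 = 0 by omega] at hpos
        simp at hpos
    exact ⟨_, _, hs.1, hs.2, hE.symm, hB, isKMinus_of_iso f h, isKMinus_of_iso' f h⟩
  · exact Or.inr (extremal_kPlus_shape f h hpos hN)
  · right
    have := extremal_kPlus_shape (f.trans bipGraphFlip) (x₀ := y₀) (y₀ := x₀) (fun y x => h x y)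
      (by rwa [badPairs_flip_card]) (by rwa [badPairs_flip_card, biEdges_flip_card])
    rwa [badPairs_flip_card, biEdges_flip_card] at this

section
variable {X Y : Type*} [Fintype X] [Fintype Y] {R : X → Y → Prop} {e : ℕ}

theorem card_badPairs_le_kMinus (he : 4 ≤ e) (hR : (biEdges R).card = e)
    (hmax : (bipGraph R).largestEigenvalue = maxNonCompleteBipartiteRadius e) {p q : ℕ}
    (hp : 2 ≤ p) (hq : 2 ≤ q) (hpq : p * q = e + 1) :
    0 < (badPairs R).card ∧ (badPairs R).card ≤ 2 * ((p - 1) * (q - 1)) + 1 ∧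
      (badPairs R).card + 4 < 2 * (biEdges R).card := by
  let Q : Fin p → Fin q → Prop := fun x y => ¬ (x = ⟨0, by omega⟩ ∧ y = ⟨0, by omega⟩)
  obtain ⟨hE, hB⟩ := card_of_kMinus (R := Q) (fun x y => Iff.rfl)
  rw [Fintype.card_fin, Fintype.card_fin] at hE hB
  -- The first inequality amounts to `p + q ≥ 5`; the only exception `p = q = 2` would mean `e = 3`.
  have hD : (p - 1) * (q - 1) + 3 ≤ e ∧ 0 < (p - 1) * (q - 1) := by
    obtain ⟨p, rfl⟩ := Nat.exists_eq_add_of_le hp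
    obtain ⟨q, rfl⟩ := Nat.exists_eq_add_of_le hq
    have h1 : 2 + p - 1 = 1 + p := by omega
    have h2 : 2 + q - 1 = 1 + q := by omega
    rw [h1, h2]
    constructor
    · rcases Nat.eq_zero_or_pos (p + q) with h0 | h0
      · obtain ⟨rfl, rfl⟩ : p = 0 ∧ q = 0 := by omega
        omega
      · nlinarith
    · positivity
  have := card_badPairs_le_of_max he hR (by omega) hB hD.2 hD.1 hmax
  exact ⟨this.1, this.2, by omega⟩

theorem card_badPairs_le_kPlus (he : 4 ≤ e) (hR : (biEdges R).card = e)
    (hmax : (bipGraph R).largestEigenvalue = maxNonCompleteBipartiteRadius e) {p q : ℕ}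
    (hp : 2 ≤ p) (hq : 2 ≤ q) (hpq : p * q + 1 = e) :
    0 < (badPairs R).card ∧ (badPairs R).card ≤ 2 * ((p - 1) * q) + 1 ∧
      (badPairs R).card + 4 < 2 * (biEdges R).card := by
  let Q : Fin p → Fin (q + 1) → Prop := fun x y => y ≠ ⟨0, by omega⟩ ∨ x = ⟨0, by omega⟩
  obtain ⟨hE, hB⟩ := card_of_kPlus (R := Q) (fun x y => Iff.rfl)
  rw [Fintype.card_fin, Fintype.card_fin, Nat.add_sub_cancel] at hE hB
  have hD : (p - 1) * q + 3 ≤ e ∧ 0 < (p - 1) * q := by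
    obtain ⟨p, rfl⟩ := Nat.exists_eq_add_of_le hp
    have h1 : 2 + p - 1 = 1 + p := by omega
    rw [h1]
    exact ⟨by nlinarith, by positivity⟩
  have := card_badPairs_le_of_max he hR (by omega) hB hD.2 hD.1 hmax
  exact ⟨this.1, this.2, by omega⟩

end

/-! ### Arithmetic of the factorisations, and the conclusion. -/

theorem three_le_of_mul_odd {s t n : ℕ} (hs : 2 ≤ s) (h : s * t = n) (hn : Odd n) : 3 ≤ s := by
  rcases Nat.lt_or_ge 2 s with h2 | h2
  · exact h2
  · obtain rfl : s = 2 := by omega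
    rw [← h] at hn
    exact absurd hn (by simp)

/-- The cofactor of the least divisor that is at least three of an odd composite number. -/
theorem two_le_div_of_isLeast {n p : ℕ} (hn : Odd n) (h2 : 2 ≤ n) (hnp : ¬ n.Prime)
    (hp : IsLeast {d : ℕ | 3 ≤ d ∧ d ∣ n} p) : 3 ≤ p ∧ p * (n / p) = n ∧ 2 ≤ n / p := by
  obtain ⟨⟨h3, hd⟩, hmin⟩ := hp
  have hmul : p * (n / p) = n := Nat.mul_div_cancel' hd
  refine ⟨h3, hmul, ?_⟩
  have hm2 : 2 ≤ n.minFac := (Nat.minFac_prime (by omega)).two_le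
  have hm3 : 3 ≤ n.minFac :=
    three_le_of_mul_odd hm2 (Nat.mul_div_cancel' n.minFac_dvd) hn
  have hle : p ≤ n.minFac := hmin ⟨hm3, n.minFac_dvd⟩
  have hlt : n.minFac < n := (Nat.not_prime_iff_minFac_lt h2).1 hnp
  by_contra! hlt2
  interval_cases (n / p) <;> omega

/-- By parity the slack 1 disappears. With equal products the inequality becomes `s + t ≥ p + q`,
whence `(s - p)(t - p) = pq - p(s + t) + p² ≤ 0`, with both factors nonnegative. -/
theorem eq_or_eq_of_kMinus_le {p q s t : ℕ} (h : s * t = p * q) (hps : p ≤ s) (hpt : p ≤ t)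
    (hp : 1 ≤ p) (hq : 1 ≤ q) (hle : 2 * ((s - 1) * (t - 1)) ≤ 2 * ((p - 1) * (q - 1)) + 1) :
    s = p ∨ t = p := by
  have hle : (s - 1) * (t - 1) ≤ (p - 1) * (q - 1) := by omega
  obtain ⟨s, rfl⟩ := Nat.exists_eq_add_of_le hps
  obtain ⟨t, rfl⟩ := Nat.exists_eq_add_of_le hpt
  obtain ⟨p, rfl⟩ := Nat.exists_eq_add_of_le' hp
  obtain ⟨q, rfl⟩ := Nat.exists_eq_add_of_le' hq
  rw [show p + 1 + s - 1 = p + s by omega, show p + 1 + t - 1 = p + t by omega,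
    Nat.add_sub_cancel, Nat.add_sub_cancel] at hle
  have hsum : q ≤ p + s + t := by nlinarith
  have : s * t = 0 := by nlinarith
  rcases Nat.mul_eq_zero.1 this with h | h <;> simp [h]

/-- With equal products the inequality becomes `t ≥ q`, which together with `s ≥ p` leaves no room.
-/
theorem eq_of_kPlus_le {p q s t : ℕ} (h : s * t = p * q) (hps : p ≤ s) (hp : 1 ≤ p) (hq : 1 ≤ q)
    (hle : 2 * ((s - 1) * t) ≤ 2 * ((p - 1) * q) + 1) : s = p := by
  have hle : (s - 1) * t ≤ (p - 1) * q := by omega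
  obtain ⟨p, rfl⟩ := Nat.exists_eq_add_of_le' hp
  obtain ⟨s, rfl⟩ := Nat.exists_eq_add_of_le' (hp.trans hps)
  simp only [Nat.add_sub_cancel] at hle
  have : q ≤ t := by nlinarith
  refine le_antisymm ?_ hps
  by_contra! hlt
  nlinarith

theorem theorem5p1 {V : Type*} [Fintype V] (G : SimpleGraph V) (e : ℕ) (he : 4 ≤ e)
    (hbip : G.IsBipartite) (hedges : G.edgeSet.ncard = e)
    (hisol : ∀ v : V, ¬ G.IsIsolated v)
    (hmax : G.largestEigenvalue = maxNonCompleteBipartiteRadius e) :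
    (Odd e → G.IsKMinus 2 ((e + 1) / 2)) ∧
    (Even e → Nat.Prime (e - 1) → ¬ Nat.Prime (e + 1) →
      ∀ p' : ℕ, IsLeast {d : ℕ | 3 ≤ d ∧ d ∣ e + 1} p' → G.IsKMinus p' ((e + 1) / p')) ∧
    (Even e → ¬ Nat.Prime (e - 1) → Nat.Prime (e + 1) →
      ∀ p'' : ℕ, IsLeast {d : ℕ | 3 ≤ d ∧ d ∣ e - 1} p'' → G.IsKPlus p'' ((e - 1) / p'')) ∧
    (Even e → ¬ Nat.Prime (e - 1) → ¬ Nat.Prime (e + 1) →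
      ∀ p' p'' : ℕ, IsLeast {d : ℕ | 3 ≤ d ∧ d ∣ e + 1} p' →
        IsLeast {d : ℕ | 3 ≤ d ∧ d ∣ e - 1} p'' →
        G.IsKMinus p' ((e + 1) / p') ∨ G.IsKPlus p'' ((e - 1) / p'')) := by
  classical
  obtain ⟨S, ⟨f⟩⟩ := hbip.exists_iso_bipGraph
  generalize hR : (fun (x : S) (y : (Sᶜ : Set V)) => G.Adj x y) = R at f
  have hX : ∀ x, ∃ y, R x y := by
    intro x
    have := hisol (f.symm (.inl x))
    simp only [SimpleGraph.IsIsolated, not_forall, not_not] at this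
    obtain ⟨w, hw⟩ := this
    have hw := f.map_adj_iff.2 hw
    rw [RelIso.apply_symm_apply] at hw
    rcases hv : f w with y | y <;> rw [hv] at hw
    · exact hw.elim
    · exact ⟨y, hw⟩
  have hY : ∀ y, ∃ x, R x y := by
    intro y
    have := hisol (f.symm (.inr y))
    simp only [SimpleGraph.IsIsolated, not_forall, not_not] at this
    obtain ⟨w, hw⟩ := this
    have hw := f.map_adj_iff.2 hw
    rw [RelIso.apply_symm_apply] at hw
    rcases hv : f w with x | x <;> rw [hv] at hw
    · exact ⟨x, hw⟩
    · exact hw.elim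
  have hE : (biEdges R).card = e := by
    rw [← ncard_edgeSet_bipGraph, ← f.ncard_edgeSet_eq, hedges]
  rw [f.largestEigenvalue_eq] at hmax
  have shape := extremal_shape f hX hY
  have leM := fun p q => card_badPairs_le_kMinus (p := p) (q := q) he hE hmax
  have leP := fun p q => card_badPairs_le_kPlus (p := p) (q := q) he hE hmax
  clear hmax hR
  rw [hE] at shape leM leP
  have minusM : Even e → ¬ (e + 1).Prime → ∀ p, IsLeast {d : ℕ | 3 ≤ d ∧ d ∣ e + 1} p →
      3 ≤ p ∧ p * ((e + 1) / p) = e + 1 ∧ 2 ≤ (e + 1) / p := fun hev hpr p hp =>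
    two_le_div_of_isLeast hev.add_one (by omega) hpr hp
  have plusP : Even e → ¬ (e - 1).Prime → ∀ p, IsLeast {d : ℕ | 3 ≤ d ∧ d ∣ e - 1} p →
      3 ≤ p ∧ p * ((e - 1) / p) = e - 1 ∧ 2 ≤ (e - 1) / p := fun hev hpr p hp =>
    two_le_div_of_isLeast (Nat.Even.sub_odd (by omega) hev odd_one) (by omega) hpr hp
  have finM : ∀ p, Even e → ¬ (e + 1).Prime → IsLeast {d : ℕ | 3 ≤ d ∧ d ∣ e + 1} p →
      ∀ s t, 2 ≤ s → 2 ≤ t → s * t = e + 1 → (badPairs R).card = 2 * ((s - 1) * (t - 1)) →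
        G.IsKMinus s t → G.IsKMinus t s → G.IsKMinus p ((e + 1) / p) := by
    intro p hev hpr hp s t hs ht hst hB h1 h2
    obtain ⟨h3, hm, hq⟩ := minusM hev hpr p hp
    obtain ⟨-, hle, -⟩ := leM p _ (by omega) hq hm
    have hs3 := three_le_of_mul_odd hs hst hev.add_one
    have ht3 := three_le_of_mul_odd ht (by rw [mul_comm, hst]) hev.add_one
    rw [hB] at hle
    rcases eq_or_eq_of_kMinus_le (hst.trans hm.symm) (hp.2 ⟨hs3, hst ▸ Nat.dvd_mul_right _ _⟩)
      (hp.2 ⟨ht3, hst ▸ Nat.dvd_mul_left _ _⟩) (by omega) (by omega) hle with rfl | rfl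
    · rwa [← hst, Nat.mul_div_cancel_left _ (by omega)]
    · rwa [← hst, Nat.mul_div_cancel _ (by omega)]
  have finP : ∀ p, Even e → ¬ (e - 1).Prime → IsLeast {d : ℕ | 3 ≤ d ∧ d ∣ e - 1} p →
      ∀ s t, 2 ≤ s → s * t + 1 = e → (badPairs R).card = 2 * ((s - 1) * t) →
        G.IsKPlus s t → G.IsKPlus p ((e - 1) / p) := by
    intro p hev hpr hp s t hs hst hB h1
    obtain ⟨h3, hm, hq⟩ := plusP hev hpr p hp
    obtain ⟨-, hle, -⟩ := leP p _ (by omega) hq (by omega)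
    have hst' : s * t = e - 1 := by omega
    have hs3 := three_le_of_mul_odd hs hst' (Nat.Even.sub_odd (by omega) hev odd_one)
    rw [hB] at hle
    obtain rfl := eq_of_kPlus_le (hst'.trans hm.symm) (hp.2 ⟨hs3, hst' ▸ Nat.dvd_mul_right _ _⟩)
      (by omega) (by omega) hle
    rwa [← hst', Nat.mul_div_cancel_left _ (by omega)]
  refine ⟨fun hodd => ?_, fun hev hp1 hp2 p hp => ?_, fun hev hp1 hp2 p hp => ?_,
    fun hev hp1 hp2 p p' hp hp' => ?_⟩
  · obtain ⟨m, rfl⟩ := hodd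
    rw [show (2 * m + 1 + 1) / 2 = m + 1 by omega]
    -- The competitor `K⁻_{2,m+1}` has `D = m`. As it is also `K⁺_{2,m}`, this one bound settles
    -- both possible shapes.
    obtain ⟨h0, h1, h2⟩ := leM 2 (m + 1) (by omega) (by omega) (by ring)
    simp only [Nat.add_one_sub_one, one_mul] at h1
    rcases shape h0 h2 with ⟨s, t, hs, ht, hst, hB, h3, h4⟩ | ⟨s, t, hs, ht, hst, hB, h3, h4⟩
    · have hst' : s * t = 2 * (m + 1) := by omega
      rcases eq_or_eq_of_kMinus_le hst' hs ht (by omega) (by omega) (by simpa [← hB] using h1) with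
        rfl | rfl
      · obtain rfl : t = m + 1 := by omega
        exact h3
      · obtain rfl : s = m + 1 := by omega
        exact h4
    · obtain rfl := eq_of_kPlus_le (p := 2) (q := m) (s := s) (t := t) (by omega) hs (by omega)
        (by omega) (by simpa [← hB] using h1)
      obtain rfl : t = m := by omega
      exact h4 rfl
  · obtain ⟨h3, hm, hq⟩ := minusM hev hp2 p hp
    obtain ⟨h0, -, h2⟩ := leM p _ (by omega) hq hm
    rcases shape h0 h2 with ⟨s, t, hs, ht, hst, hB, h4, h5⟩ | ⟨s, t, hs, ht, hst, hB, h4, h5⟩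
    · exact finM p hev hp2 hp s t hs ht hst hB h4 h5
    · refine absurd hp1 ?_
      rw [← hst, Nat.add_sub_cancel]
      exact Nat.not_prime_mul (by omega) (by omega)
  · obtain ⟨h3, hm, hq⟩ := plusP hev hp1 p hp
    obtain ⟨h0, -, h2⟩ := leP p _ (by omega) hq (by omega)
    rcases shape h0 h2 with ⟨s, t, hs, ht, hst, hB, h4, h5⟩ | ⟨s, t, hs, ht, hst, hB, h4, h5⟩
    · refine absurd hp2 ?_
      rw [← hst]
      exact Nat.not_prime_mul (by omega) (by omega)
    · exact finP p hev hp1 hp s t hs hst hB h4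
  · obtain ⟨h3, hm, hq⟩ := minusM hev hp2 p hp
    -- Either family of competitors would give the smallness of `N` needed for the shape; the
    -- optimal factorisation is then found within the family that occurs.
    obtain ⟨h0, -, h2⟩ := leM p _ (by omega) hq hm
    rcases shape h0 h2 with ⟨s, t, hs, ht, hst, hB, h4, h5⟩ | ⟨s, t, hs, ht, hst, hB, h4, h5⟩
    · exact Or.inl (finM p hev hp2 hp s t hs ht hst hB h4 h5)
    · exact Or.inr (finP p' hev hp1 hp' s t hs hst hB h4)
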